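/- Fix an integer $d\ge 3$. For $N\ge d$ let $G$ be a uniformly random simple $d$-regular bipartite graph on $2N$ labelled vertices with two prescribed colour classes of $N$ vertices each, and let $V$ be its vertex set. A randomized algorithm on $G$ consists of finitely many independent random variables (seeds) $Z_1,\dots,Z_m$ with values in arbitrary measurable spaces, subsets $W_1,\dots,W_m\subseteq V$, and, for each $v\in V$, a $\{0,1\}$-valued random variable $X_v$ that is a measurable function of those $Z_i$ for which $v\in W_i$; we say that the seed $Z_i$ influences the vertices in $W_i$. The algorithm produces an independent set if almost surely $\{v\in V : X_v=1\}$ is an independent set of $G$, and this independent set has homogeneous density at least $q$ if $\mathbb{P}(X_v=1)\ge q$ for every $v\in V$. **Theorem.** For every $\delta>0$ there exists $\varepsilon>0$, depending only on $d$ and $\delta$, such that with probability tending to $1$ as $N\to\infty$ the graph $G$ has the following property: no randomized algorithm on $G$ with $|W_i|\le(1-\delta)\,|V|$ for all $i$ produces an independent set of homogeneous density at least $1/2-\varepsilon$ (that is, for every such algorithm producing an independent set, some vertex $v$ satisfies $\mathbb{P}(X_v=1)<1/2-\varepsilon$). -/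

import Mathlib

open MeasureTheory ProbabilityTheory Filter Topology

universe u w

/-- A randomized algorithm on a finite vertex set `V`. There are finitely many independent random
seeds `Z i`, defined on a common probability space; the seed `Z i` is passed on exactly to the
vertices in `W i`, and every vertex `v` decides, by a measurable rule applied to the seeds it
receives, whether it outputs `true` (the value `1`) or `false` (the value `0`). -/
structure SeedAlgorithm (V : Type*) where
  /-- the underlying probability space -/
  Ω : Type u
  [measurableSpaceΩ : MeasurableSpace Ω]
  P : Measure Ω
  [isProbabilityMeasure : IsProbabilityMeasure P]
  /-- the number of seeds -/
  m : ℕ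
  /-- the space in which the `i`-th seed takes its values -/
  S : Fin m → Type w
  [measurableSpaceS : ∀ i, MeasurableSpace (S i)]
  /-- the random seeds -/
  Z : ∀ i, Ω → S i
  measurable_Z : ∀ i, Measurable (Z i)
  indep_Z : iIndepFun Z P
  /-- the set of vertices that the `i`-th seed influences -/
  W : Fin m → Finset V
  /-- the decision rule of a vertex, a function of the seeds that influence it -/
  rule : ∀ v : V, (∀ i : {i : Fin m // v ∈ W i}, S i) → Bool
  measurable_rule : ∀ v, Measurable (rule v)

namespace SeedAlgorithm

attribute [instance] measurableSpaceΩ isProbabilityMeasure measurableSpaceS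

variable {V : Type*}

/-- The random variable `X v`: the output of the vertex `v`. -/
def X (A : SeedAlgorithm.{u, w} V) (v : V) (ω : A.Ω) : Bool :=
  A.rule v (fun i => A.Z i ω)

/-- The random set of vertices whose output is `1`. -/
def outputSet (A : SeedAlgorithm.{u, w} V) (ω : A.Ω) : Set V :=
  {v | A.X v ω = true}

/-- Each seed influences at most a fraction `r` of the vertices. -/
def InfluenceAtMost [Fintype V] (A : SeedAlgorithm.{u, w} V) (r : ℝ) : Prop :=
  ∀ i, ((A.W i).card : ℝ) ≤ r * Fintype.card V

/-- The algorithm produces an independent set of `G` (almost surely). -/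
def ProducesIndepSet (A : SeedAlgorithm.{u, w} V) (G : SimpleGraph V) : Prop :=
  ∀ᵐ ω ∂A.P, G.IsIndepSet (A.outputSet ω)

/-- The homogeneous density of the output is at least `q`: every vertex is included in the output
set with probability at least `q`. -/
def HomogeneousDensityAtLeast (A : SeedAlgorithm.{u, w} V) (q : ℝ) : Prop :=
  ∀ v, q ≤ A.P.real {ω | v ∈ A.outputSet ω}

end SeedAlgorithm

/-- The set of all simple `d`-regular bipartite graphs on `2 N` labelled vertices, with `N` vertices
in each of the two colour classes. -/
def regularBipartiteGraphs (d N : ℕ) : Set (SimpleGraph (Fin N ⊕ Fin N)) :=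
  {G | G.IsBipartiteWith (Set.range Sum.inl) (Set.range Sum.inr) ∧
    ∀ v, (G.neighborSet v).ncard = d}

/-- The probability that a uniformly random simple `d`-regular bipartite graph on `2 N` vertices
has the property `Q` (such graphs exist for all `N ≥ d`; the value is `0` if there are none). -/
noncomputable def probRegularBipartite (d N : ℕ)
    (Q : SimpleGraph (Fin N ⊕ Fin N) → Prop) : ℝ :=
  ({G ∈ regularBipartiteGraphs d N | Q G}.ncard : ℝ) / (regularBipartiteGraphs d N).ncard

/-! Let s and t count the output vertices in the two colour classes. The proof plays two estimates
for the variance of the imbalance s − t against each other.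

Upper bound: when every seed reaches at most R of the variables Y_v, the variance of ∑ Y_v is at
most R ∑ Var Y_v (`variance_sum_le_of_dependsOn`), an Efron–Stein type refinement of Cauchy–Schwarz.
With R = (1 − δ)·2N and 2N indicators of variance at most 1/4, this gives Var(s − t) ≤ (1 − δ)N².

Lower bound: in a typical G, two sets in opposite classes with no edge between them cannot both be
large and together have almost N vertices. An independent set of size close to N therefore lies
almost entirely in one class, so (s − t)² is close to N². Homogeneous density close to 1/2 makes the
size close to N on average and the means of s and t almost equal, so Var(s − t) is close to N², a
contradiction (`SeedAlgorithm.not_homogeneousDensityAtLeast`).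

Typical graphs have this property by a first moment bound. Switchings compare graphs with j and with
j + 1 edges between S and T. Iterating up to a well-chosen j shows that the proportion with no such
edge is about C(s+t, s)^(−d), now with s = |S| and t = |T|, up to factors of small exponential rate
when s + t is near N. There are about C(s+t, s)² pairs (S, T) of given sizes, so d ≥ 3 leaves an
exponential gain (`choose_mul_choose_mul_card_le`). -/

/-! ### Variance of sums under bounded influence -/

/-- The law of total variance for a bounded function on a product of two probability spaces. -/
theorem variance_prod_eq {α β : Type*} [MeasurableSpace α] [MeasurableSpace β] (μ : Measure α)
    (ν : Measure β) [IsProbabilityMeasure μ] [IsProbabilityMeasure ν] {f : α × β → ℝ}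
    (hf : Measurable f) {C : ℝ} (hC : ∀ x, |f x| ≤ C) :
    Var[f; μ.prod ν] = ∫ a, Var[fun b => f (a, b); ν] ∂μ + Var[fun a => ∫ b, f (a, b) ∂ν; μ] := by
  have hfa : ∀ a, Measurable fun b => f (a, b) := fun a => hf.comp measurable_prodMk_left
  have hI : Measurable fun a => ∫ b, f (a, b) ∂ν :=
    hf.stronglyMeasurable.integral_prod_right'.measurable
  have hIC : ∀ a, |∫ b, f (a, b) ∂ν| ≤ C := fun a => by
    simpa using norm_integral_le_of_norm_le_const (μ := ν) (C := C)
      (f := fun b => f (a, b)) (ae_of_all _ fun b => hC (a, b))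
  have hsq : ∀ x, |(f ^ 2) x| ≤ C ^ 2 := fun x => by
    simpa [abs_pow] using pow_le_pow_left₀ (abs_nonneg _) (hC x) 2
  have hf2 : Measurable (f ^ 2) := hf.pow_const 2
  have hint2 : Integrable (f ^ 2) (μ.prod ν) :=
    Integrable.of_bound hf2.aestronglyMeasurable (C ^ 2) (ae_of_all _ hsq)
  have hint : Integrable f (μ.prod ν) :=
    Integrable.of_bound hf.aestronglyMeasurable C (ae_of_all _ hC)
  rw [variance_eq_sub (MemLp.of_bound hf.aestronglyMeasurable C (ae_of_all _ hC)),
    variance_eq_sub (MemLp.of_bound hI.aestronglyMeasurable C (ae_of_all _ hIC)),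
    integral_prod _ hint2, integral_prod _ hint]
  have h1 : ∀ a, Var[fun b => f (a, b); ν]
      = ∫ b, (f ^ 2) (a, b) ∂ν - (∫ b, f (a, b) ∂ν) ^ 2 := fun a => by
    rw [variance_eq_sub (MemLp.of_bound (hfa a).aestronglyMeasurable C
      (ae_of_all _ fun b => hC (a, b)))]
    rfl
  simp_rw [h1]
  have hint3 : Integrable (fun a => (∫ b, f (a, b) ∂ν) ^ 2) μ :=
    Integrable.of_bound (hI.pow_const 2).aestronglyMeasurable (C ^ 2) (ae_of_all _ fun a => by
      simpa [abs_pow] using pow_le_pow_left₀ (abs_nonneg _) (hIC a) 2)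
  rw [integral_sub hint2.integral_prod_left hint3]
  simp only [Pi.pow_apply]
  ring

/-- If all but at most `R` of the functions `h v` are constant, then the variance of the sum is at
most `R` times the sum of the variances. -/
theorem variance_sum_le_of_const {α V : Type*} [Fintype V] [DecidableEq V] [MeasurableSpace α]
    (μ : Measure α)
    [IsProbabilityMeasure μ] {h : V → α → ℝ} (hm : ∀ v, Measurable (h v)) {C : ℝ}
    (hC : ∀ v x, |h v x| ≤ C) (W : Finset V) {R : ℝ} (hR : (W.card : ℝ) ≤ R)
    (hW : ∀ v, v ∉ W → ∀ a a', h v a = h v a') :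
    Var[fun a => ∑ v, h v a; μ] ≤ R * ∑ v, Var[h v; μ] := by
  have hint : ∀ v, Integrable (h v) μ := fun v =>
    Integrable.of_bound (hm v).aestronglyMeasurable C (ae_of_all _ (hC v))
  rw [variance_eq_integral (Finset.measurable_sum _ fun v _ => hm v).aemeasurable]
  simp_rw [fun v => variance_eq_integral (hm v).aemeasurable (μ := μ)]
  rw [integral_finsetSum _ fun v _ => hint v]
  have hb : ∀ v x, |h v x - ∫ y, h v y ∂μ| ≤ C + C := fun v x => by
    refine (abs_sub _ _).trans (add_le_add (hC v x) ?_)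
    simpa using norm_integral_le_of_norm_le_const (μ := μ) (C := C)
      (f := h v) (ae_of_all _ (hC v))
  have hint2 : ∀ v, Integrable (fun x => (h v x - ∫ y, h v y ∂μ) ^ 2) μ := fun v =>
    Integrable.of_bound (((hm v).sub_const _).pow_const 2).aestronglyMeasurable ((C + C) ^ 2)
      (ae_of_all _ fun x => by
        simpa [abs_pow] using pow_le_pow_left₀ (abs_nonneg _) (hb v x) 2)
  have hz : ∀ v, v ∉ W → ∀ x, h v x - ∫ y, h v y ∂μ = 0 := fun v hv x => by
    have : ∀ y, h v y = h v x := fun y => hW v hv y x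
    simp [this]
  rw [← integral_finsetSum _ fun v _ => hint2 v, ← integral_const_mul]
  -- Pointwise Cauchy–Schwarz over `W` alone, since the centred terms outside `W` vanish.
  have key : ∀ x, (∑ v, h v x - ∑ v, ∫ y, h v y ∂μ) ^ 2
      ≤ R * ∑ v, (h v x - ∫ y, h v y ∂μ) ^ 2 := fun x => by
    rw [← Finset.sum_sub_distrib, ← Finset.sum_subset (Finset.subset_univ W)
      (fun v _ hv => hz v hv x), ← Finset.sum_subset (Finset.subset_univ W)
      (fun v _ hv => by rw [hz v hv x]; simp)]
    exact sq_sum_le_card_mul_sum_sq.trans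
      (mul_le_mul_of_nonneg_right hR (Finset.sum_nonneg fun _ _ => sq_nonneg _))
  refine integral_mono_of_nonneg (ae_of_all _ fun x => sq_nonneg _) ?_ (ae_of_all _ key)
  exact (integrable_finsetSum _ fun v _ => hint2 v).const_mul _

/-- A variance inequality for functions of independent random variables: if every coordinate
influences at most `R` of the functions `Y v`, then the variance of the sum is at most `R` times
the sum of the variances. -/
theorem variance_sum_le_of_dependsOn {V : Type*} [Fintype V] [DecidableEq V] {C R : ℝ} :
    ∀ (m : ℕ) (S : Fin m → Type w) [∀ i, MeasurableSpace (S i)] (μ : ∀ i, Measure (S i))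
      [∀ i, IsProbabilityMeasure (μ i)] (W : Fin m → Finset V) (_ : ∀ i, ((W i).card : ℝ) ≤ R)
      (Y : V → (∀ i, S i) → ℝ) (_ : ∀ v, Measurable (Y v)) (_ : ∀ v x, |Y v x| ≤ C)
      (_ : ∀ v, DependsOn (Y v) {i | v ∈ W i}),
      Var[fun x => ∑ v, Y v x; Measure.pi μ] ≤ R * ∑ v, Var[Y v; Measure.pi μ]
  | 0, S, _, μ, _, W, hW, Y, hY, hC, hdep => by
    have h0 : ∀ f : (∀ i, S i) → ℝ, Var[f; Measure.pi μ] = 0 := fun f => by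
      have : f = fun _ => f (fun i => i.elim0) := funext fun x => congrArg f (Subsingleton.elim _ _)
      rw [this, variance_eq_integral aemeasurable_const]; simp
    simp [h0]
  | m + 1, S, _, μ, _, W, hW, Y, hY, hC, hdep => by
    set e := MeasurableEquiv.piFinSuccAbove S 0 with he
    set ν := Measure.pi fun j => μ ((0 : Fin (m + 1)).succAbove j) with hν
    have hmp : MeasurePreserving e.symm ((μ 0).prod ν) (Measure.pi μ) :=
      (measurePreserving_piFinSuccAbove μ 0).symm
    have hvar : ∀ f : (∀ i, S i) → ℝ, Measurable f →
        Var[f; Measure.pi μ] = Var[fun p => f (e.symm p); (μ 0).prod ν] := fun f hf =>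
      (hmp.variance_fun_comp hf.aemeasurable).symm
    have happ0 : ∀ a b, e.symm (a, b) 0 = a := fun a b => rfl
    have happ : ∀ a b j, e.symm (a, b) ((0 : Fin (m + 1)).succAbove j) = b j := fun a b j => rfl
    have hsum : Measurable fun x => ∑ v, Y v x := Finset.measurable_sum _ fun v _ => hY v
    have hYe : ∀ v, Measurable fun p => Y v (e.symm p) := fun v => (hY v).comp e.symm.measurable
    have hsume : Measurable fun p => ∑ v, Y v (e.symm p) := hsum.comp e.symm.measurable
    have hsC : ∀ x, |∑ v, Y v x| ≤ ∑ _v : V, C := fun x =>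
      (Finset.abs_sum_le_sum_abs _ _).trans (Finset.sum_le_sum fun v _ => hC v x)
    have hYa : ∀ v a, Measurable fun b => Y v (e.symm (a, b)) := fun v a =>
      (hYe v).comp measurable_prodMk_left
    have hYi : ∀ v a, Integrable (fun b => Y v (e.symm (a, b))) ν := fun v a =>
      Integrable.of_bound (hYa v a).aestronglyMeasurable C (ae_of_all _ fun b => hC v _)
    -- Total variance is split along coordinate 0 on both sides. The conditional variances compare
    -- by induction for each frozen value `a`. The conditional means of the `Y v` with `v ∉ W 0` do
    -- not depend on `a`, so `variance_sum_le_of_const` handles their variance.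
    rw [hvar _ hsum, variance_prod_eq _ _ hsume (fun p => hsC _)]
    simp_rw [fun v => hvar _ (hY v), fun v => variance_prod_eq (μ 0) ν (hYe v) (fun p => hC v _)]
    rw [Finset.sum_add_distrib, mul_add]
    refine add_le_add ?_ ?_
    · have hVm : ∀ v, Integrable (fun a => Var[fun b => Y v (e.symm (a, b)); ν]) (μ 0) := fun v => by
        have hE : Measurable fun a => ∫ b, Y v (e.symm (a, b)) ∂ν :=
          (hYe v).stronglyMeasurable.integral_prod_right'.measurable
        have hE2 : Measurable fun a => ∫ b, (Y v (e.symm (a, b))) ^ 2 ∂ν :=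
          ((hYe v).pow_const 2).stronglyMeasurable.integral_prod_right'.measurable
        have heq : (fun a => Var[fun b => Y v (e.symm (a, b)); ν]) = fun a =>
            ∫ b, (Y v (e.symm (a, b))) ^ 2 ∂ν - (∫ b, Y v (e.symm (a, b)) ∂ν) ^ 2 := by
          funext a
          rw [variance_eq_sub (MemLp.of_bound (hYa v a).aestronglyMeasurable C
            (ae_of_all _ fun b => hC v _))]
          rfl
        refine Integrable.of_bound ?_ (((C - -C) / 2) ^ 2) (ae_of_all _ fun a => ?_)
        · rw [heq]; exact (hE2.sub (hE.pow_const 2)).aestronglyMeasurable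
        · rw [Real.norm_of_nonneg (variance_nonneg _ _)]
          exact variance_le_sq_of_bounded (ae_of_all _ fun b => abs_le.1 (hC v _))
            (hYa v a).aemeasurable
      rw [← integral_finsetSum _ fun v _ => hVm v, ← integral_const_mul]
      refine integral_mono_of_nonneg (ae_of_all _ fun a => variance_nonneg _ _)
        ((integrable_finsetSum _ fun v _ => hVm v).const_mul _) (ae_of_all _ fun a => ?_)
      refine variance_sum_le_of_dependsOn m (fun j => S ((0 : Fin (m + 1)).succAbove j))
        (fun j => μ ((0 : Fin (m + 1)).succAbove j)) (fun j => W ((0 : Fin (m + 1)).succAbove j))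
        (fun j => hW _) (fun v b => Y v (e.symm (a, b))) (fun v => hYa v a) (fun v b => hC v _) ?_
      intro v b b' hb
      refine hdep v fun i hi => ?_
      induction i using Fin.succAboveCases (0 : Fin (m + 1)) with
      | x => rfl
      | p j => exact hb j hi
    · simp_rw [fun a => integral_finsetSum Finset.univ fun v _ => hYi v a]
      refine variance_sum_le_of_const (C := C) _ (fun v => ?_) (fun v a => ?_) (W 0) (hW 0) ?_
      · exact (hYe v).stronglyMeasurable.integral_prod_right'.measurable
      · refine (norm_integral_le_of_norm_le_const (C := C)
          (f := fun b => Y v (e.symm (a, b))) (ae_of_all ν fun b => hC v _)).trans_eq ?_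
        rw [probReal_univ, mul_one]
      · intro v hv a a'
        refine integral_congr_ae (ae_of_all _ fun b => hdep v fun i hi => ?_)
        induction i using Fin.succAboveCases (0 : Fin (m + 1)) with
        | x => exact absurd hi hv
        | p j => rfl

/-! ### Variance of the imbalance of the output -/

/-- If two numbers with sum at most `n` are such that one of them is small or their sum is not
close to `n`, then the square of their difference is close to `n ^ 2`, up to an error controlled
by `n - (s + t)`. -/
theorem sq_sub_sq_sub_le {s t n η c : ℝ} (hs : 0 ≤ s) (ht : 0 ≤ t) (hst : s + t ≤ n) (hη : 0 < η)
    (hc : 0 < c) (h : s < η * n ∨ t < η * n ∨ s + t < (1 - c) * n) :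
    n ^ 2 - (s - t) ^ 2 ≤ n * ((2 + c⁻¹) * (n - (s + t)) + 4 * η * n) := by
  have hn : 0 ≤ n := by linarith
  have hgap : 0 ≤ n - (s + t) := by linarith
  have hci : 0 < c⁻¹ := inv_pos.2 hc
  have hηn : 0 ≤ η * n := by positivity
  have h1 : 0 ≤ n * (c⁻¹ * (n - (s + t))) := by positivity
  have e : n * ((2 + c⁻¹) * (n - (s + t)) + 4 * η * n)
      = n * (2 * (n - (s + t)) + 4 * (η * n)) + n * (c⁻¹ * (n - (s + t))) := by ring
  rw [e]
  -- With u = n − (s + t), the left side is u(n + s + t) + 4st ≤ 2nu + 4st. If s or t is below ηn,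
  -- then st ≤ ηn². Otherwise u > cn, and n·c⁻¹u alone exceeds n².
  rcases h with h | h | h
  · nlinarith [mul_nonneg hn hgap, mul_nonneg hn (sub_nonneg.2 h.le), mul_nonneg hs ht,
      mul_nonneg hs hgap, mul_nonneg ht hgap]
  · nlinarith [mul_nonneg hn hgap, mul_nonneg hn (sub_nonneg.2 h.le), mul_nonneg hs ht,
      mul_nonneg hs hgap, mul_nonneg ht hgap]
  · have h2 : n ≤ c⁻¹ * (n - (s + t)) := by
      rw [← div_eq_inv_mul, le_div_iff₀ hc]; linarith
    nlinarith [mul_le_mul_of_nonneg_left h2 hn, mul_nonneg hn hgap, mul_nonneg hn hηn,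
      sq_nonneg (s - t)]

namespace SeedAlgorithm

variable {V : Type*} (A : SeedAlgorithm.{u, w} V)

theorem measurable_X (v : V) : Measurable (A.X v) :=
  (A.measurable_rule v).comp (measurable_pi_lambda _ fun i => A.measurable_Z i)

/-- The variance inequality for sums of functions of the outputs of the vertices. -/
theorem variance_sum_le [Fintype V] [DecidableEq V] {r C : ℝ} (hr : A.InfluenceAtMost r)
    (g : V → Bool → ℝ) (hg : ∀ v b, |g v b| ≤ C) :
    Var[fun ω => ∑ v, g v (A.X v ω); A.P]
      ≤ r * Fintype.card V * ∑ v, Var[fun ω => g v (A.X v ω); A.P] := by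
  have : ∀ i, IsProbabilityMeasure (A.P.map (A.Z i)) := fun i =>
    Measure.isProbabilityMeasure_map (A.measurable_Z i).aemeasurable
  have hZ : Measurable fun ω i => A.Z i ω := measurable_pi_lambda _ A.measurable_Z
  have hmap := (iIndepFun_iff_map_fun_eq_pi_map
    fun i => (A.measurable_Z i).aemeasurable).1 A.indep_Z
  have hY : ∀ v, Measurable fun z : ∀ i, A.S i => g v (A.rule v fun i => z i) := fun v =>
    (measurable_of_finite (g v)).comp ((A.measurable_rule v).comp
      (measurable_pi_lambda _ fun i => measurable_pi_apply _))
  have hvar : ∀ f : (∀ i, A.S i) → ℝ, Measurable f →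
      Var[f; Measure.pi fun i => A.P.map (A.Z i)] = Var[fun ω => f fun i => A.Z i ω; A.P] :=
    fun f hf => by
      rw [← hmap, variance_map hf.aemeasurable hZ.aemeasurable]; rfl
  have key := variance_sum_le_of_dependsOn A.m A.S (fun i => A.P.map (A.Z i)) A.W hr
    (fun v z => g v (A.rule v fun i => z i)) hY (fun v z => hg v _) (fun v x y hxy => by
      have : (fun i : {i : Fin A.m // v ∈ A.W i} => x i) =
          fun i : {i : Fin A.m // v ∈ A.W i} => y i :=
        funext fun i => hxy i i.2
      simp only [this])
  rw [hvar _ (Finset.measurable_sum _ fun v _ => hY v)] at key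
  simp_rw [fun v => hvar _ (hY v)] at key
  exact key

/-- If an algorithm with bounded influence on `2 N` vertices almost surely outputs a set that is
lopsided, or not close to half of the vertices, then its homogeneous density is not close
to one half. -/
theorem not_homogeneousDensityAtLeast {N : ℕ} (hN : 0 < N)
    (A : SeedAlgorithm.{u, w} (Fin N ⊕ Fin N)) {δ η c ε : ℝ} (hδ : δ ≤ 1) (hη : 0 < η) (hc : 0 < c)
    (hε : (4 + 2 * c⁻¹) * ε + 4 * η + 4 * ε ^ 2 < δ) (hA : A.InfluenceAtMost (1 - δ))
    (hI : ∀ᵐ ω ∂A.P, ∃ S T : Finset (Fin N), (∀ i, i ∈ S ↔ Sum.inl i ∈ A.outputSet ω) ∧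
      (∀ j, j ∈ T ↔ Sum.inr j ∈ A.outputSet ω) ∧ S.card + T.card ≤ N ∧
      ((S.card : ℝ) < η * N ∨ (T.card : ℝ) < η * N ∨ ((S.card : ℝ) + T.card) < (1 - c) * N)) :
    ¬ A.HomogeneousDensityAtLeast (1 / 2 - ε) := by
  intro hD
  let b : Bool → ℝ := fun x => if x = true then 1 else 0
  -- Complementing the right outputs turns the total into s − t + N while every summand stays in {0,
  -- 1}, so its variance is at most 1/4.
  let g : Fin N ⊕ Fin N → Bool → ℝ := Sum.elim (fun _ x => b x) (fun _ x => 1 - b x)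
  have hb : ∀ x, b x = 0 ∨ b x = 1 := by intro x; cases x <;> simp [b]
  have hg01 : ∀ v x, g v x = 0 ∨ g v x = 1 := by
    rintro (i | j) x <;> rcases hb x with h | h <;> simp [g, h]
  have hg : ∀ v x, |g v x| ≤ 1 := fun v x => by rcases hg01 v x with h | h <;> simp [h]
  have hgm : ∀ v, Measurable fun ω => g v (A.X v ω) := fun v =>
    (measurable_of_finite (g v)).comp (A.measurable_X v)
  have hbm : ∀ v, Measurable fun ω => b (A.X v ω) := fun v =>
    (measurable_of_finite b).comp (A.measurable_X v)
  have hN' : (0 : ℝ) < N := by exact_mod_cast hN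
  have hbi : ∀ v, Integrable (fun ω => b (A.X v ω)) A.P := fun v =>
    Integrable.of_bound (hbm v).aestronglyMeasurable 1
      (ae_of_all _ fun ω => by rcases hb (A.X v ω) with h | h <;> simp [h])
  have hden : ∀ v, 1 / 2 - ε ≤ ∫ ω, b (A.X v ω) ∂A.P := fun v => by
    refine (hD v).trans_eq ?_
    have hms : MeasurableSet {ω | v ∈ A.outputSet ω} :=
      (A.measurable_X v) (measurableSet_singleton true)
    rw [← integral_indicator_one hms]
    refine integral_congr_ae (ae_of_all _ fun ω => ?_)
    by_cases h : A.X v ω = true <;> simp [b, Set.indicator, outputSet, h]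
  set s : A.Ω → ℝ := fun ω => ∑ i, b (A.X (Sum.inl i) ω) with hs
  set t : A.Ω → ℝ := fun ω => ∑ j, b (A.X (Sum.inr j) ω) with ht
  have hsi : Integrable s A.P := integrable_finsetSum _ fun i _ => hbi _
  have hti : Integrable t A.P := integrable_finsetSum _ fun i _ => hbi _
  have hsm : Measurable s := Finset.measurable_sum _ fun i _ => hbm _
  have htm : Measurable t := Finset.measurable_sum _ fun i _ => hbm _
  have hs0 : ∀ ω, 0 ≤ s ω := fun ω => Finset.sum_nonneg fun i _ => by
    rcases hb (A.X (Sum.inl i) ω) with h | h <;> simp [h]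
  have ht0 : ∀ ω, 0 ≤ t ω := fun ω => Finset.sum_nonneg fun i _ => by
    rcases hb (A.X (Sum.inr i) ω) with h | h <;> simp [h]
  have hae : ∀ᵐ ω ∂A.P, s ω + t ω ≤ N ∧
      (s ω < η * N ∨ t ω < η * N ∨ s ω + t ω < (1 - c) * N) := by
    filter_upwards [hI] with ω ⟨S, T, hS, hT, hST, h⟩
    have e1 : s ω = S.card := by
      have : S = Finset.univ.filter fun i => A.X (Sum.inl i) ω = true := by
        ext i; simp [hS, outputSet]
      simp [hs, b, this]
    have e2 : t ω = T.card := by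
      have : T = Finset.univ.filter fun i => A.X (Sum.inr i) ω = true := by
        ext i; simp [hT, outputSet]
      simp [ht, b, this]
    rw [e1, e2]
    exact ⟨by exact_mod_cast hST, h⟩
  have hsE : (1 / 2 - ε) * N ≤ ∫ ω, s ω ∂A.P := by
    rw [hs, integral_finsetSum _ fun i _ => hbi _]
    calc (1 / 2 - ε) * N = ∑ _i : Fin N, (1 / 2 - ε) := by
          rw [Finset.sum_const, Finset.card_univ, Fintype.card_fin, nsmul_eq_mul, mul_comm]
      _ ≤ _ := Finset.sum_le_sum fun i _ => hden _
  have htE : (1 / 2 - ε) * N ≤ ∫ ω, t ω ∂A.P := by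
    rw [ht, integral_finsetSum _ fun i _ => hbi _]
    calc (1 / 2 - ε) * N = ∑ _i : Fin N, (1 / 2 - ε) := by
          rw [Finset.sum_const, Finset.card_univ, Fintype.card_fin, nsmul_eq_mul, mul_comm]
      _ ≤ _ := Finset.sum_le_sum fun i _ => hden _
  have hstE : ∫ ω, s ω ∂A.P + ∫ ω, t ω ∂A.P ≤ N := by
    rw [← integral_add hsi hti]
    refine (integral_mono_ae (hsi.add hti) (integrable_const (N : ℝ)) ?_).trans_eq (by simp)
    filter_upwards [hae] with ω h using h.1
  have hsum : ∀ ω, ∑ v, g v (A.X v ω) = s ω - t ω + N := fun ω => by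
    simp [Fintype.sum_sum_type, g, hs, ht]; ring
  have hsN : ∀ ω, s ω ≤ N := fun ω => by
    calc s ω ≤ ∑ _i : Fin N, (1 : ℝ) := Finset.sum_le_sum fun i _ => by
          rcases hb (A.X (Sum.inl i) ω) with h | h <;> simp [h]
      _ = N := by simp
  have htN : ∀ ω, t ω ≤ N := fun ω => by
    calc t ω ≤ ∑ _i : Fin N, (1 : ℝ) := Finset.sum_le_sum fun i _ => by
          rcases hb (A.X (Sum.inr i) ω) with h | h <;> simp [h]
      _ = N := by simp
  have hdb : ∀ ω, |s ω - t ω| ≤ N := fun ω => by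
    rw [abs_le]; constructor <;> linarith [hs0 ω, ht0 ω, hsN ω, htN ω]
  have hd2 : MemLp (fun ω => s ω - t ω) 2 A.P :=
    MemLp.of_bound (hsm.sub htm).aestronglyMeasurable N (ae_of_all _ hdb)
  have hup : Var[fun ω => s ω - t ω; A.P] ≤ (1 - δ) * N ^ 2 := by
    have h1 := A.variance_sum_le hA g hg
    simp_rw [hsum] at h1
    rw [variance_add_const (X := fun ω => s ω - t ω) (hsm.sub htm).aestronglyMeasurable] at h1
    refine h1.trans ?_
    have h2 : ∑ v, Var[fun ω => g v (A.X v ω); A.P] ≤ ∑ _v : Fin N ⊕ Fin N, ((1 - 0) / 2) ^ 2 :=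
      Finset.sum_le_sum fun v _ => variance_le_sq_of_bounded (ae_of_all _ fun ω => by
        rcases hg01 v (A.X v ω) with h | h <;> simp [h]) (hgm v).aemeasurable
    have h3 : (0 : ℝ) ≤ (1 - δ) * Fintype.card (Fin N ⊕ Fin N) :=
      mul_nonneg (by linarith) (Nat.cast_nonneg _)
    refine (mul_le_mul_of_nonneg_left h2 h3).trans_eq ?_
    simp; ring
  have hlow : (N : ℝ) ^ 2 - N * ((2 + c⁻¹) * (N - (∫ ω, s ω ∂A.P + ∫ ω, t ω ∂A.P)) + 4 * η * N)
      ≤ ∫ ω, (s ω - t ω) ^ 2 ∂A.P := by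
    -- The pointwise lower bound for (s − t)² is affine in s + t, so it passes to expectations.
    have haff : ∀ x y : ℝ, (N : ℝ) ^ 2 - N * ((2 + c⁻¹) * (N - (x + y)) + 4 * η * N)
        = (N ^ 2 - N * ((2 + c⁻¹) * N + 4 * η * N)) + N * (2 + c⁻¹) * (x + y) := fun x y => by ring
    have hst : Integrable (fun ω => s ω + t ω) A.P := hsi.add hti
    have hint : Integrable (fun ω => (N : ℝ) ^ 2
        - N * ((2 + c⁻¹) * (N - (s ω + t ω)) + 4 * η * N)) A.P := by
      simp_rw [haff]
      exact (integrable_const _).add (hst.const_mul _)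
    have heq : ∫ ω, ((N : ℝ) ^ 2 - N * ((2 + c⁻¹) * (N - (s ω + t ω)) + 4 * η * N)) ∂A.P
        = (N : ℝ) ^ 2
          - N * ((2 + c⁻¹) * (N - (∫ ω, s ω ∂A.P + ∫ ω, t ω ∂A.P)) + 4 * η * N) := by
      simp_rw [haff]
      rw [integral_add (integrable_const _) (hst.const_mul _), integral_const_mul,
        integral_add hsi hti]
      simp
    rw [← heq]
    refine integral_mono_ae hint hd2.integrable_sq ?_
    filter_upwards [hae] with ω h
    have := sq_sub_sq_sub_le (hs0 ω) (ht0 ω) h.1 hη hc h.2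
    linarith
  rw [variance_eq_sub hd2, integral_sub hsi hti] at hup
  simp only [Pi.pow_apply] at hup
  set a := ∫ ω, s ω ∂A.P
  set e := ∫ ω, t ω ∂A.P
  have hci : 0 < c⁻¹ := inv_pos.2 hc
  -- Both means are at least (1/2 − ε)N and add up to at most N, so they differ by at most 2εN and N
  -- − (a + e) ≤ 2εN. The variance is then at least N²(1 − (4 + 2c⁻¹)ε − 4η − 4ε²), which `hε`
  -- places above (1 − δ)N².
  have h1 : (a - e) ^ 2 ≤ (2 * ε * N) ^ 2 := by
    refine sq_le_sq.2 (le_trans ?_ (le_abs_self _))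
    rw [abs_le]; constructor <;> nlinarith
  have h2 : N * ((2 + c⁻¹) * (N - (a + e))) ≤ N * ((2 + c⁻¹) * (2 * ε * N)) := by
    gcongr; linarith
  have h3 : 0 < (N : ℝ) ^ 2 := by positivity
  nlinarith [mul_lt_mul_of_pos_right hε h3]

end SeedAlgorithm

/-! ### Switchings in regular bipartite graphs -/

section Switching

variable {α β : Type*}

/-- The edges `p` and `q` of `E` are at distance at least two, so that they can be switched. -/
def CanSwitch (E : Finset (α × β)) (p q : α × β) : Prop :=
  p ∈ E ∧ q ∈ E ∧ (p.1, q.2) ∉ E ∧ (q.1, p.2) ∉ E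

theorem CanSwitch.fst_ne {E : Finset (α × β)} {p q : α × β} (h : CanSwitch E p q) : p.1 ≠ q.1 :=
  fun he => h.2.2.1 (by rw [he]; exact h.2.1)

variable [DecidableEq α] [DecidableEq β]

/-- A bipartite graph, given by its set of edges, is `d`-regular. -/
def IsBiregular (d : ℕ) (E : Finset (α × β)) : Prop :=
  (∀ i, (E.filter fun p => p.1 = i).card = d) ∧ ∀ j, (E.filter fun p => p.2 = j).card = d

/-- The edges between the vertex sets `S` and `T`. -/
def edgesBetween (E : Finset (α × β)) (S : Finset α) (T : Finset β) : Finset (α × β) :=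
  E.filter fun p => p.1 ∈ S ∧ p.2 ∈ T

theorem mem_edgesBetween {E : Finset (α × β)} {S : Finset α} {T : Finset β} {p : α × β} :
    p ∈ edgesBetween E S T ↔ p ∈ E ∧ p.1 ∈ S ∧ p.2 ∈ T := by
  simp [edgesBetween]

theorem IsBiregular.card_filter_fst {d : ℕ} {E : Finset (α × β)} (hE : IsBiregular d E)
    (S : Finset α) : (E.filter fun p => p.1 ∈ S).card = d * S.card := by
  rw [Finset.card_eq_sum_card_fiberwise (f := Prod.fst) (t := S) (fun p hp => by simp_all),
    mul_comm, Finset.sum_const_nat]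
  intro i hi
  rw [← hE.1 i, Finset.filter_filter]
  congr 1; ext p; simp only [Finset.mem_filter]
  exact ⟨fun h => ⟨h.1, h.2.2⟩, fun h => ⟨h.1, h.2 ▸ hi, h.2⟩⟩

theorem IsBiregular.card_filter_snd {d : ℕ} {E : Finset (α × β)} (hE : IsBiregular d E)
    (T : Finset β) : (E.filter fun p => p.2 ∈ T).card = d * T.card := by
  rw [Finset.card_eq_sum_card_fiberwise (f := Prod.snd) (t := T) (fun p hp => by simp_all),
    mul_comm, Finset.sum_const_nat]
  intro j hj
  rw [← hE.2 j, Finset.filter_filter]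
  congr 1; ext p; simp only [Finset.mem_filter]
  exact ⟨fun h => ⟨h.1, h.2.2⟩, fun h => ⟨h.1, h.2 ▸ hj, h.2⟩⟩

/-- Replace the edges `p` and `q` by the edges `(p.1, q.2)` and `(q.1, p.2)`. -/
def switchEdges (E : Finset (α × β)) (p q : α × β) : Finset (α × β) :=
  insert (p.1, q.2) (insert (q.1, p.2) ((E.erase p).erase q))

/-- With arbitrary weights, indicators of a row, a column or a box give the effect on degrees and on
edge counts between two sets. The removed weights stand on the left to avoid truncated subtraction.
-/
theorem CanSwitch.sum_switchEdges {E : Finset (α × β)} {p q : α × β} (h : CanSwitch E p q)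
    (f : α × β → ℕ) :
    ∑ x ∈ switchEdges E p q, f x + (f p + f q) = ∑ x ∈ E, f x + (f (p.1, q.2) + f (q.1, p.2)) := by
  have hpq : q ≠ p := fun he => h.fst_ne (by rw [he])
  have h1 : (q.1, p.2) ∉ (E.erase p).erase q := fun hm =>
    h.2.2.2 (Finset.mem_of_mem_erase (Finset.mem_of_mem_erase hm))
  have h2 : (p.1, q.2) ∉ insert (q.1, p.2) ((E.erase p).erase q) := fun hm => by
    rcases Finset.mem_insert.1 hm with he | hm
    · exact h.fst_ne (Prod.mk.inj he).1
    · exact h.2.2.1 (Finset.mem_of_mem_erase (Finset.mem_of_mem_erase hm))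
  rw [switchEdges, Finset.sum_insert h2, Finset.sum_insert h1, ← Finset.add_sum_erase E f h.1,
    ← Finset.add_sum_erase (E.erase p) f (Finset.mem_erase.2 ⟨hpq, h.2.1⟩)]
  ring

theorem CanSwitch.isBiregular {d : ℕ} {E : Finset (α × β)} {p q : α × β} (h : CanSwitch E p q)
    (hE : IsBiregular d E) : IsBiregular d (switchEdges E p q) := by
  refine ⟨fun i => ?_, fun j => ?_⟩
  · have := h.sum_switchEdges fun x => if x.1 = i then 1 else 0
    rw [← hE.1 i, Finset.card_filter, Finset.card_filter]
    dsimp only at this; omega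
  · have := h.sum_switchEdges fun x => if x.2 = j then 1 else 0
    rw [← hE.2 j, Finset.card_filter, Finset.card_filter]
    dsimp only at this; omega

theorem CanSwitch.card_edgesBetween {E : Finset (α × β)} {p q : α × β} (h : CanSwitch E p q)
    {S : Finset α} {T : Finset β} (hp1 : p.1 ∈ S) (hp2 : p.2 ∉ T) (hq1 : q.1 ∉ S) (hq2 : q.2 ∈ T) :
    (edgesBetween (switchEdges E p q) S T).card = (edgesBetween E S T).card + 1 := by
  have := h.sum_switchEdges fun x => if x.1 ∈ S ∧ x.2 ∈ T then 1 else 0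
  rw [edgesBetween, edgesBetween, Finset.card_filter, Finset.card_filter]
  simpa [hp1, hp2, hq1, hq2] using this

/-- Reversibility makes the double counting map injective. -/
theorem CanSwitch.switchEdges_switchEdges {E : Finset (α × β)} {p q : α × β}
    (h : CanSwitch E p q) : switchEdges (switchEdges E p q) (p.1, q.2) (q.1, p.2) = E := by
  obtain ⟨hp, hq, hpq, hqp⟩ := h
  ext x
  simp only [switchEdges, Finset.mem_insert, Finset.mem_erase]
  constructor
  · rintro (rfl | rfl | ⟨h1, h2, h3 | h3 | h3⟩)
    · exact hp
    · exact hq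
    · exact absurd h3 h2
    · exact absurd h3 h1
    · exact h3.2.2
  · intro hx
    by_cases h1 : x = p
    · exact Or.inl h1
    by_cases h2 : x = q
    · exact Or.inr (Or.inl h2)
    refine Or.inr (Or.inr ⟨?_, ?_, Or.inr (Or.inr ⟨h2, h1, hx⟩)⟩)
    · rintro rfl; exact hqp hx
    · rintro rfl; exact hpq hx

/-- For fixed `p`, an edge `q` is forbidden only if its right end is a neighbour of `p.1` or its
left end is a neighbour of `p.2`. Each condition excludes at most d·d edges. Edges sharing an end
with `p` are among these. -/
theorem IsBiregular.le_card_canSwitch {d : ℕ} {E : Finset (α × β)} (hE : IsBiregular d E)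
    (A B : Finset (α × β)) (hA : A ⊆ E) (hB : B ⊆ E) [DecidablePred fun x : (α × β) × (α × β) =>
      CanSwitch E x.1 x.2] :
    A.card * (B.card - 2 * d ^ 2) ≤ ((A ×ˢ B).filter fun x => CanSwitch E x.1 x.2).card := by
  classical
  have hfib : ∀ p ∈ A, B.card - 2 * d ^ 2 ≤
      (((A ×ˢ B).filter fun x => CanSwitch E x.1 x.2).filter fun x => x.1 = p).card := by
    intro p hp
    set N₂ := (E.filter fun x => x.1 = p.1).image Prod.snd with hN₂
    set N₁ := (E.filter fun x => x.2 = p.2).image Prod.fst with hN₁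
    have h1 : (E.filter fun x => x.2 ∈ N₂).card ≤ d ^ 2 := by
      rw [hE.card_filter_snd, pow_two]
      exact Nat.mul_le_mul_left _ (Finset.card_image_le.trans (hE.1 _).le)
    have h2 : (E.filter fun x => x.1 ∈ N₁).card ≤ d ^ 2 := by
      rw [hE.card_filter_fst, pow_two]
      exact Nat.mul_le_mul_left _ (Finset.card_image_le.trans (hE.2 _).le)
    have h3 : (B \ ((E.filter fun x => x.2 ∈ N₂) ∪ (E.filter fun x => x.1 ∈ N₁))).card ≤
        (((A ×ˢ B).filter fun x => CanSwitch E x.1 x.2).filter fun x => x.1 = p).card := by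
      refine Finset.card_le_card_of_injOn (fun q => (p, q)) (fun q hq => ?_)
        (fun q _ q' _ h => congrArg Prod.snd h)
      simp only [Finset.coe_sdiff, Set.mem_sdiff, Finset.mem_coe, Finset.mem_union,
        Finset.mem_filter, not_or, not_and] at hq
      simp only [Finset.coe_filter, Finset.mem_filter, Finset.mem_product, Set.mem_ofPred_eq,
        and_true]
      refine ⟨⟨hp, hq.1⟩, hA hp, hB hq.1, fun h => hq.2.1 (hB hq.1) ?_,
        fun h => hq.2.2 (hB hq.1) ?_⟩
      · exact Finset.mem_image.2 ⟨_, Finset.mem_filter.2 ⟨h, rfl⟩, rfl⟩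
      · exact Finset.mem_image.2 ⟨_, Finset.mem_filter.2 ⟨h, rfl⟩, rfl⟩
    have h4 := Finset.le_card_sdiff
      ((E.filter fun x => x.2 ∈ N₂) ∪ (E.filter fun x => x.1 ∈ N₁)) B
    have h5 := Finset.card_union_le (E.filter fun x => x.2 ∈ N₂) (E.filter fun x => x.1 ∈ N₁)
    omega
  rw [Finset.card_eq_sum_card_fiberwise (f := Prod.fst) (t := A)
    (s := (A ×ˢ B).filter fun x => CanSwitch E x.1 x.2) (fun x hx => by simp_all)]
  simpa using Finset.card_nsmul_le_sum A _ _ hfib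

theorem IsBiregular.card_edgesBetween_compl_right [Fintype β] {d : ℕ} {E : Finset (α × β)}
    (hE : IsBiregular d E) (S : Finset α) (T : Finset β) :
    (edgesBetween E S T).card + (edgesBetween E S Tᶜ).card = d * S.card := by
  rw [← hE.card_filter_fst, ← Finset.card_filter_add_card_filter_not
    (s := E.filter fun p => p.1 ∈ S) (fun p => p.2 ∈ T),
    Finset.filter_filter, Finset.filter_filter]
  simp [edgesBetween]

theorem IsBiregular.card_edgesBetween_compl_left [Fintype α] {d : ℕ} {E : Finset (α × β)}
    (hE : IsBiregular d E) (S : Finset α) (T : Finset β) :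
    (edgesBetween E S T).card + (edgesBetween E Sᶜ T).card = d * T.card := by
  rw [← hE.card_filter_snd, ← Finset.card_filter_add_card_filter_not
    (s := E.filter fun p => p.2 ∈ T) (fun p => p.1 ∈ S),
    Finset.filter_filter, Finset.filter_filter]
  simp [edgesBetween, and_comm]

variable [Fintype α] [Fintype β]

open Classical in
/-- The `d`-regular bipartite graphs with exactly `j` edges between `S` and `T`. -/
noncomputable def biregularWith (d : ℕ) (S : Finset α) (T : Finset β) (j : ℕ) :
    Finset (Finset (α × β)) :=
  Finset.univ.filter fun E => IsBiregular d E ∧ (edgesBetween E S T).card = j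

theorem mem_biregularWith {d : ℕ} {S : Finset α} {T : Finset β} {j : ℕ} {E : Finset (α × β)} :
    E ∈ biregularWith d S T j ↔ IsBiregular d E ∧ (edgesBetween E S T).card = j := by
  simp [biregularWith]

/-- Double counting of switchings. -/
theorem card_biregularWith_mul_le {d D : ℕ} {S : Finset α} {T : Finset β}
    (hD : D + d * S.card + d * T.card = d * Fintype.card β) (j : ℕ) :
    (biregularWith d S T j).card * ((d * S.card - j) * (d * (T.card - 2 * d) - j)) ≤
      (biregularWith d S T (j + 1)).card * ((j + 1) * (j + 1 + D)) := by
  classical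
  -- `F` lists the switchings that create exactly one edge between `S` and `T`. `B` lists all pairs
  -- of edges that could arise from one, with no switchability required, which is enough for an
  -- upper bound.
  let F : (E : Finset (α × β)) → Finset ((α × β) × (α × β)) := fun E =>
    (edgesBetween E S Tᶜ ×ˢ edgesBetween E Sᶜ T).filter fun x => CanSwitch E x.1 x.2
  let B : (E : Finset (α × β)) → Finset ((α × β) × (α × β)) := fun E =>
    edgesBetween E S T ×ˢ edgesBetween E Sᶜ Tᶜ
  have hF : (biregularWith d S T j).card * ((d * S.card - j) * (d * (T.card - 2 * d) - j)) ≤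
      ((biregularWith d S T j).sigma F).card := by
    rw [Finset.card_sigma, ← smul_eq_mul]
    refine Finset.card_nsmul_le_sum _ _ _ fun E hE => ?_
    obtain ⟨hE, hj⟩ := mem_biregularWith.1 hE
    refine le_trans (le_of_eq ?_) (hE.le_card_canSwitch
      (edgesBetween E S Tᶜ) (edgesBetween E Sᶜ T) (Finset.filter_subset _ _)
      (Finset.filter_subset _ _))
    have h1 := hE.card_edgesBetween_compl_right S T
    have h2 := hE.card_edgesBetween_compl_left S T
    -- The 2d² lost edges are absorbed by shrinking |T| by 2d, which keeps the factor in a form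
    -- suited to binomial coefficients.
    have h3 : d * (T.card - 2 * d) = d * T.card - 2 * d ^ 2 := by
      rw [Nat.mul_sub]; ring_nf
    congr 1 <;> omega
  have hB : ((biregularWith d S T (j + 1)).sigma B).card ≤
      (biregularWith d S T (j + 1)).card * ((j + 1) * (j + 1 + D)) := by
    rw [Finset.card_sigma, ← smul_eq_mul]
    refine Finset.sum_le_card_nsmul _ _ _ fun E hE => le_of_eq ?_
    obtain ⟨hE, hj⟩ := mem_biregularWith.1 hE
    have h1 := hE.card_edgesBetween_compl_right S T
    have h2 := hE.card_edgesBetween_compl_left S Tᶜ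
    have h3 : d * T.card + d * Tᶜ.card = d * Fintype.card β := by
      rw [← Nat.mul_add, Finset.card_add_card_compl]
    simp only [B, Finset.card_product]
    congr 1; omega
  refine hF.trans (le_trans ?_ hB)
  refine Finset.card_le_card_of_injOn
    (fun x => ⟨switchEdges x.1 x.2.1 x.2.2, (x.2.1.1, x.2.2.2), (x.2.2.1, x.2.1.2)⟩) ?_ ?_
  · rintro ⟨E, p, q⟩ hx
    simp only [Finset.coe_sigma, Set.mem_sigma_iff, Finset.mem_coe, F, Finset.mem_filter,
      Finset.mem_product, mem_edgesBetween, Finset.mem_compl] at hx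
    obtain ⟨hE, ⟨⟨-, hp1, hp2⟩, -, hq1, hq2⟩, hs⟩ := hx
    obtain ⟨hE, hj⟩ := mem_biregularWith.1 hE
    simp only [Finset.coe_sigma, Set.mem_sigma_iff, Finset.mem_coe, B,
      Finset.mem_product, mem_edgesBetween, Finset.mem_compl]
    refine ⟨mem_biregularWith.2 ⟨hs.isBiregular hE, ?_⟩, ⟨?_, hp1, hq2⟩, ?_, hq1, hp2⟩
    · rw [hs.card_edgesBetween hp1 hp2 hq1 hq2, hj]
    · simp [switchEdges]
    · simp [switchEdges]
  · rintro ⟨E, p, q⟩ hx ⟨E', p', q'⟩ hx' h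
    simp only [Finset.coe_sigma, Set.mem_sigma_iff, Finset.mem_coe, F, Finset.mem_filter] at hx hx'
    simp only [Sigma.mk.injEq, heq_eq_eq, Prod.mk.injEq] at h
    obtain ⟨hsw, ⟨h1, h2⟩, h3, h4⟩ := h
    obtain rfl : p = p' := Prod.ext h1 h4
    obtain rfl : q = q' := Prod.ext h3 h2
    have := hx.2.2.switchEdges_switchEdges
    rw [show switchEdges E p q = switchEdges E' p q from hsw, hx'.2.2.switchEdges_switchEdges] at this
    rw [this]

/-- The switching inequality telescopes: the product over i < j of (d|S| − i)(d(|T| − 2d) − i) / ((i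
+ 1)(i + 1 + D)) is the quotient of these binomial coefficients. -/
theorem card_biregularWith_zero_mul_le {d D : ℕ} {S : Finset α} {T : Finset β}
    (hD : D + d * S.card + d * T.card = d * Fintype.card β) (j : ℕ) :
    (biregularWith d S T 0).card * ((d * S.card).choose j * (d * (T.card - 2 * d)).choose j) ≤
      (j + D).choose j * (biregularWith d S T j).card := by
  induction j with
  | zero => simp
  | succ j ih =>
    refine Nat.le_of_mul_le_mul_right (c := (j + 1) * (j + 1)) ?_ (by positivity)
    have e1 := Nat.choose_succ_right_eq (d * S.card) j
    have e2 := Nat.choose_succ_right_eq (d * (T.card - 2 * d)) j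
    have e3 : (j + 1 + D).choose (j + 1) * (j + 1) = (j + D).choose j * (j + 1 + D) := by
      rw [show j + 1 + D = j + D + 1 by ring, ← Nat.add_one_mul_choose_eq, mul_comm]
    calc _ = (biregularWith d S T 0).card * (((d * S.card).choose (j + 1) * (j + 1)) *
          ((d * (T.card - 2 * d)).choose (j + 1) * (j + 1))) := by ring
      _ = (biregularWith d S T 0).card *
          ((d * S.card).choose j * (d * (T.card - 2 * d)).choose j) *
          ((d * S.card - j) * (d * (T.card - 2 * d) - j)) := by rw [e1, e2]; ring
      _ ≤ (j + D).choose j * (biregularWith d S T j).card *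
          ((d * S.card - j) * (d * (T.card - 2 * d) - j)) := Nat.mul_le_mul_right _ ih
      _ = (j + D).choose j * ((biregularWith d S T j).card *
          ((d * S.card - j) * (d * (T.card - 2 * d) - j))) := by ring
      _ ≤ (j + D).choose j * ((biregularWith d S T (j + 1)).card * ((j + 1) * (j + 1 + D))) :=
          Nat.mul_le_mul_left _ (card_biregularWith_mul_le hD j)
      _ = ((j + D).choose j * (j + 1 + D)) * (biregularWith d S T (j + 1)).card * (j + 1) := by
          ring
      _ = _ := by rw [← e3]; ring

end Switching

/-! ### Estimates for binomial coefficients -/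

section Binomial

/-- Some term of Vandermonde's sum of s + 1 terms is at least the average. -/
theorem exists_choose_add_le (s t : ℕ) :
    ∃ k ≤ s, (s + t).choose s ≤ (s + 1) * (s.choose k * t.choose k) := by
  by_contra! h
  have h1 : (s + t).choose s
      = ∑ k ∈ Finset.range (s + 1), s.choose k * t.choose k := by
    rw [Nat.add_choose_eq, Finset.Nat.sum_antidiagonal_eq_sum_range_succ_mk,
      ← Finset.sum_range_reflect]
    refine Finset.sum_congr rfl fun k hk => ?_
    have hk : k ≤ s := by simpa [Nat.lt_succ_iff] using hk
    rw [show s + 1 - 1 - k = s - k by omega, Nat.sub_sub_self hk, Nat.choose_symm hk]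
  have h2 : ∑ k ∈ Finset.range (s + 1), (s + 1) * (s.choose k * t.choose k)
      < ∑ _k ∈ Finset.range (s + 1), (s + t).choose s :=
    Finset.sum_lt_sum_of_nonempty (by simp) fun k hk => h k (by simpa [Nat.lt_succ_iff] using hk)
  rw [← Finset.mul_sum, ← h1] at h2
  simp at h2

/-- Choosing k elements in each of d blocks of size n is one way to choose dk elements; the
induction keeps a single Vandermonde term. -/
theorem choose_pow_le_choose_mul (n k d : ℕ) : n.choose k ^ d ≤ (d * n).choose (d * k) := by
  induction d with
  | zero => simp
  | succ d ih =>
    rw [pow_succ, Nat.succ_mul, Nat.succ_mul, Nat.add_choose_eq]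
    refine (Nat.mul_le_mul_right _ ih).trans ?_
    exact Finset.single_le_sum (f := fun ij : ℕ × ℕ => (d * n).choose ij.1 * n.choose ij.2)
      (fun _ _ => Nat.zero_le _) (Finset.HasAntidiagonal.mem_antidiagonal.2 (rfl : (d * k, k).1 + (d * k, k).2 = _))

/-- By Pascal's rule, raising both `a` and `b` by one at least doubles the coefficient. This is the
source of the exponential gain. -/
theorem two_pow_le_choose_add (k : ℕ) : ∀ a b : ℕ, k ≤ a → k ≤ b → 2 ^ k ≤ (a + b).choose a := by
  induction k with
  | zero => intro a b _ _; exact Nat.choose_pos (Nat.le_add_right a b)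
  | succ k ih =>
    intro a b ha hb
    obtain ⟨a, rfl⟩ := Nat.exists_eq_add_of_le' (Nat.one_le_of_lt ha)
    obtain ⟨b, rfl⟩ := Nat.exists_eq_add_of_le' (Nat.one_le_of_lt hb)
    have h := ih a b (by omega) (by omega)
    have h1 : (a + b).choose a ≤ (a + b + 1).choose a := Nat.choose_le_succ _ _
    have h2 : (a + b + 1).choose (a + 1) = (a + b).choose a + (a + b).choose (a + 1) :=
      Nat.choose_succ_succ _ _
    rw [show a + 1 + (b + 1) = a + b + 1 + 1 by ring, Nat.choose_succ_succ, pow_succ]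
    simp only [Nat.succ_eq_add_one]
    omega

/-- Each increment of the upper index multiplies the coefficient by (n + l + 1)/(n + l + 1 − s),
which is at most K. -/
theorem choose_add_le_pow_mul {K : ℝ} (hK : 0 ≤ K) {N n s : ℕ} (hs : s ≤ n)
    (hN : (N : ℝ) ≤ K * (n + 1 - s)) (l : ℕ) (hl : n + l ≤ N) :
    ((n + l).choose s : ℝ) ≤ K ^ l * n.choose s := by
  induction l with
  | zero => simp
  | succ l ih =>
    have h1 := Nat.choose_mul_succ_eq (n + l) s
    have h2 : (((n + l).choose s : ℕ) : ℝ) * (n + l + 1)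
        = ((n + l + 1).choose s : ℕ) * (n + l + 1 - s) := by
      have := congrArg (Nat.cast (R := ℝ)) h1
      rw [Nat.cast_mul, Nat.cast_mul, Nat.cast_sub (by omega)] at this
      push_cast at this
      exact this
    have hs' : (s : ℝ) ≤ n := by exact_mod_cast hs
    have hl0 : (0 : ℝ) ≤ l := l.cast_nonneg
    have hl' : (n : ℝ) + l + 1 ≤ N := by exact_mod_cast hl
    have h3 : (n : ℝ) + l + 1 ≤ K * (n + l + 1 - s) := by nlinarith
    have hpos : (0 : ℝ) < n + l + 1 - s := by linarith
    have h4 : (((n + l + 1).choose s : ℕ) : ℝ) ≤ K * (n + l).choose s := by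
      refine le_of_mul_le_mul_right ?_ hpos
      rw [← h2]
      calc _ ≤ (((n + l).choose s : ℕ) : ℝ) * (K * (n + l + 1 - s)) := by gcongr
        _ = _ := by ring
    calc (((n + (l + 1)).choose s : ℕ) : ℝ) ≤ K * (n + l).choose s := h4
      _ ≤ K * (K ^ l * n.choose s) := by gcongr; exact ih (by omega)
      _ = _ := by ring

/-- This keeps one term of the expansion of (1 + x)^n. A small x brings the base near 1, and the
price x^(−k) is affordable when k is a small fraction of n. -/
theorem choose_le_one_add_pow_mul {x : ℝ} (hx : 0 < x) (n k : ℕ) :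
    (n.choose k : ℝ) ≤ (1 + x) ^ n * (x⁻¹) ^ k := by
  rcases le_or_gt k n with hk | hk
  · have h : (n.choose k : ℝ) * x ^ k ≤ (1 + x) ^ n := by
      rw [add_comm, add_pow]
      have := Finset.single_le_sum (f := fun m => x ^ m * 1 ^ (n - m) * (n.choose m : ℝ))
        (fun m _ => by positivity) (Finset.mem_range.2 (Nat.lt_succ_of_le hk))
      simpa [mul_comm] using this
    rw [inv_pow, ← div_eq_mul_inv, le_div_iff₀ (by positivity)]
    exact h
  · rw [Nat.choose_eq_zero_of_lt hk]; simp; positivity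

end Binomial

/-! ### First moment bound for nonexpanding graphs -/

section FirstMoment

variable {α β : Type*} [DecidableEq α] [DecidableEq β] [Fintype α] [Fintype β]

open Classical in
/-- The set of all `d`-regular bipartite graphs. -/
noncomputable def biregularGraphs (α β : Type*) [DecidableEq α] [DecidableEq β] [Fintype α]
    [Fintype β] (d : ℕ) :
    Finset (Finset (α × β)) :=
  Finset.univ.filter fun E => IsBiregular d E

theorem mem_biregularGraphs {d : ℕ} {E : Finset (α × β)} :
    E ∈ biregularGraphs α β d ↔ IsBiregular d E := by
  simp [biregularGraphs]

/-- The empty class is compared with the class of j = dk edges, where k comes from a large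
Vandermonde term. The latter class is bounded by all regular graphs. -/
theorem card_biregularWith_zero_mul_choose_le {d D : ℕ} {S : Finset α} {T : Finset β}
    (hD : D + d * S.card + d * T.card = d * Fintype.card β) :
    (biregularWith d S T 0).card * (S.card + (T.card - 2 * d)).choose S.card ^ d ≤
      (S.card + 1) ^ d * ((d * S.card + D).choose D * (biregularGraphs α β d).card) := by
  obtain ⟨k, hk, h⟩ := exists_choose_add_le S.card (T.card - 2 * d)
  have h1 := card_biregularWith_zero_mul_le hD (d * k)
  have h2 : (biregularWith d S T (d * k)).card ≤ (biregularGraphs α β d).card :=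
    Finset.card_le_card fun E hE => mem_biregularGraphs.2 (mem_biregularWith.1 hE).1
  have h3 : (d * k + D).choose (d * k) ≤ (d * S.card + D).choose D := by
    rw [Nat.choose_symm_add]
    exact Nat.choose_le_choose _ (Nat.add_le_add_right (Nat.mul_le_mul_left _ hk) _)
  calc _ ≤ (biregularWith d S T 0).card *
        ((S.card + 1) * (S.card.choose k * (T.card - 2 * d).choose k)) ^ d := by gcongr
    _ = (S.card + 1) ^ d * ((biregularWith d S T 0).card *
        (S.card.choose k ^ d * (T.card - 2 * d).choose k ^ d)) := by
      rw [mul_pow, mul_pow]; ring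
    _ ≤ (S.card + 1) ^ d * ((biregularWith d S T 0).card *
        ((d * S.card).choose (d * k) * (d * (T.card - 2 * d)).choose (d * k))) := by
      gcongr <;> exact choose_pow_le_choose_mul _ _ _
    _ ≤ (S.card + 1) ^ d * ((d * k + D).choose (d * k) * (biregularWith d S T (d * k)).card) := by
      gcongr
    _ ≤ _ := by gcongr

/-- Let P = C(s + t − 2d, s). Both C(N, s) and C(N, t) are P up to powers of 2/η, and P³ ≤ P^d
because d ≥ 3: two factors P pay for the choice of `S` and `T`, and the third is at least 2^(ηN/2).
The l = N − s − t ≤ cN uncovered vertices cost the factor raised to the power c. -/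
theorem choose_mul_choose_mul_card_le {d N : ℕ} (hd : 3 ≤ d)
    (hβ : Fintype.card β = N) {η c x : ℝ} (hη : 0 < η) (hη1 : η ≤ 1) (hx : 0 < x) (hx1 : x ≤ 1)
    {S : Finset α} {T : Finset β} (hS : η * N ≤ S.card) (hT : η * N ≤ T.card)
    (hST : S.card + T.card ≤ N) (hc : (1 - c) * N ≤ S.card + T.card)
    (hN : 4 * d ≤ η * N) :
    (2 : ℝ) ^ (η / 2 * N) * (N.choose S.card * N.choose T.card * (biregularWith d S T 0).card) ≤
      ((2 / η) ^ (4 * d) * (N + 1) ^ d) *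
        ((((2 / η) ^ 2 * (x⁻¹) ^ d) ^ c * (1 + x) ^ d) ^ N * (biregularGraphs α β d).card) := by
  obtain ⟨l, hl⟩ := Nat.exists_eq_add_of_le hST
  have hD : d * l + d * S.card + d * T.card = d * Fintype.card β := by rw [hβ, hl]; ring
  have hmain := card_biregularWith_zero_mul_choose_le hD
  have hmain' : ((biregularWith d S T 0).card : ℝ) *
      ((S.card + (T.card - 2 * d)).choose S.card : ℝ) ^ d ≤ (S.card + 1) ^ d *
        ((d * S.card + d * l).choose (d * l) * ((biregularGraphs α β d).card : ℝ)) := by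
    exact_mod_cast hmain
  clear hmain hD
  have hg : (0 : ℝ) ≤ (biregularWith d S T 0).card := Nat.cast_nonneg _
  have hG : (0 : ℝ) ≤ (biregularGraphs α β d).card := Nat.cast_nonneg _
  generalize ((biregularWith d S T 0).card : ℝ) = g at *
  generalize ((biregularGraphs α β d).card : ℝ) = G at *
  generalize S.card = s at *
  generalize T.card = t at *
  -- Since 4d ≤ ηN, both s and t − 2d are at least ηN/2 = N/K, which bounds every ratio in
  -- `choose_add_le_pow_mul` by K.
  set K : ℝ := 2 / η with hKdef
  clear_value K
  have hK1 : 1 ≤ K := by rw [hKdef, le_div_iff₀ hη]; linarith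
  have hK0 : 0 ≤ K := by linarith
  have h2dt : 2 * d ≤ t := by
    have : (2 * d : ℝ) ≤ t := by linarith [(Nat.cast_nonneg d : (0 : ℝ) ≤ d)]
    exact_mod_cast this
  obtain ⟨t', ht'⟩ := Nat.exists_eq_add_of_le h2dt
  have ht'' : t - 2 * d = t' := by omega
  have hd0 : (0 : ℝ) ≤ d := d.cast_nonneg
  have htr : (t : ℝ) = 2 * d + t' := by exact_mod_cast ht'
  have hKN : ∀ y : ℝ, η * N / 2 ≤ y → (N : ℝ) ≤ K * y := fun y hy => by
    calc (N : ℝ) = K * (η * N / 2) := by rw [hKdef]; field_simp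
      _ ≤ K * y := by gcongr
  have hNr : (N : ℝ) = s + t + l := by exact_mod_cast hl
  have hηN : 0 ≤ η * N := by positivity
  have hlc : (l : ℝ) ≤ c * N := by linarith
  rw [ht''] at hmain'
  set n := s + t' with hn
  set P : ℝ := (n.choose s : ℝ) with hP
  have hb1 : (N.choose s : ℝ) ≤ K ^ (2 * d + l) * P := by
    have := choose_add_le_pow_mul (N := N) hK0 (s := s) (n := n) (by omega)
      (hKN _ (by rw [hn]; push_cast; linarith)) (2 * d + l) (by omega)
    rwa [show n + (2 * d + l) = N by omega] at this
  have hb2 : (N.choose t : ℝ) ≤ K ^ (2 * d + l) * P := by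
    have h1 := choose_add_le_pow_mul (N := N) hK0 (s := t) (n := s + t) (by omega)
      (hKN _ (by push_cast; linarith)) l (by omega)
    have h2 := choose_add_le_pow_mul (N := N) hK0 (s := s) (n := n) (by omega)
      (hKN _ (by rw [hn]; push_cast; linarith)) (2 * d) (by omega)
    rw [show n + 2 * d = s + t by omega, Nat.choose_symm_add] at h2
    rw [show s + t + l = N by omega] at h1
    calc (N.choose t : ℝ) ≤ K ^ l * (K ^ (2 * d) * P) := h1.trans (by gcongr)
      _ = _ := by ring
  have hPpow : (2 : ℝ) ^ (η / 2 * N) ≤ P := by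
    have h1 := two_pow_le_choose_add (min s t') s t' (min_le_left _ _) (min_le_right _ _)
    have h2 : ((2 ^ min s t' : ℕ) : ℝ) ≤ P := by rw [hP]; exact_mod_cast h1
    refine le_trans ?_ h2
    push_cast
    rw [← Real.rpow_natCast]
    refine Real.rpow_le_rpow_of_exponent_le one_le_two ?_
    rw [Nat.cast_min]
    refine le_min ?_ ?_ <;> linarith
  have hP1 : (1 : ℝ) ≤ P := by
    rw [hP]; exact_mod_cast Nat.choose_pos (show s ≤ n by omega)
  have hPd : (P : ℝ) ^ 2 * P ≤ P ^ d := by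
    rw [← pow_succ]; exact pow_le_pow_right₀ hP1 hd
  have hchoose : ((d * s + d * l).choose (d * l) : ℝ) ≤ ((1 + x) ^ d) ^ N * ((x⁻¹) ^ d) ^ l := by
    refine (choose_le_one_add_pow_mul hx _ _).trans ?_
    rw [← pow_mul, ← pow_mul]
    gcongr
    · linarith
    · rw [hl, ← Nat.mul_add]; exact Nat.mul_le_mul_left _ (by omega)
  set M : ℝ := K ^ 2 * (x⁻¹) ^ d with hM
  have hM1 : 1 ≤ M := by
    have : 1 ≤ x⁻¹ := (one_le_inv₀ hx).2 hx1
    exact one_le_mul_of_one_le_of_one_le (one_le_pow₀ hK1) (one_le_pow₀ this)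
  have hMl : M ^ l ≤ (M ^ c) ^ N := by
    rw [← Real.rpow_natCast, ← Real.rpow_natCast, ← Real.rpow_mul (by linarith)]
    exact Real.rpow_le_rpow_of_exponent_le hM1 hlc
  clear_value M P n
  have hsN : (s : ℝ) ≤ N := by rw [hNr]; linarith [(Nat.cast_nonneg l : (0 : ℝ) ≤ l),
    (Nat.cast_nonneg t : (0 : ℝ) ≤ t)]
  calc (2 : ℝ) ^ (η / 2 * N) * (N.choose s * N.choose t * g)
      ≤ P * ((K ^ (2 * d + l) * P) * (K ^ (2 * d + l) * P) * g) := by gcongr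
    _ = K ^ (4 * d) * (K ^ 2) ^ l * (g * (P ^ 2 * P)) := by
      rw [show 4 * d = 2 * d + 2 * d by ring, ← pow_mul, two_mul l, pow_add, pow_add, pow_add]; ring
    _ ≤ K ^ (4 * d) * (K ^ 2) ^ l * (g * P ^ d) := by gcongr
    _ ≤ K ^ (4 * d) * (K ^ 2) ^ l *
        ((N + 1) ^ d * ((((1 + x) ^ d) ^ N * ((x⁻¹) ^ d) ^ l) * G)) := by
      refine mul_le_mul_of_nonneg_left (hmain'.trans ?_) (by positivity)
      gcongr
    _ = (K ^ (4 * d) * (N + 1) ^ d) * (M ^ l * ((1 + x) ^ d) ^ N * G) := by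
      rw [hM, mul_pow]; ring
    _ ≤ (K ^ (4 * d) * (N + 1) ^ d) * ((M ^ c) ^ N * ((1 + x) ^ d) ^ N * G) := by gcongr
    _ = _ := by rw [mul_pow]

/-- Each of the possible sizes contributes 1, so a union bound with these weights costs only a
polynomial factor. -/
theorem sum_inv_choose_card (α : Type*) [Fintype α] :
    ∑ S : Finset α, ((Fintype.card α).choose S.card : ℝ)⁻¹ = Fintype.card α + 1 := by
  rw [← Finset.powerset_univ, Finset.sum_powerset_apply_card
    (fun m => ((Fintype.card α).choose m : ℝ)⁻¹), Finset.card_univ]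
  rw [Finset.sum_congr rfl (g := fun _ => (1 : ℝ))]
  · simp
  · intro m hm
    have : 0 < (Fintype.card α).choose m :=
      Nat.choose_pos (by simpa [Nat.lt_succ_iff] using hm)
    rw [nsmul_eq_mul, mul_inv_cancel₀ (by exact_mod_cast this.ne')]

open Classical in
/-- The `d`-regular bipartite graphs with two large vertex sets on the two sides that cover almost
half of the vertices and have no edge between them. -/
noncomputable def nonexpandingGraphs (α β : Type*) [DecidableEq α] [DecidableEq β] [Fintype α]
    [Fintype β] (d : ℕ) (η c : ℝ) :
    Finset (Finset (α × β)) :=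
  (biregularGraphs α β d).filter fun E => ∃ (S : Finset α) (T : Finset β),
    edgesBetween E S T = ∅ ∧ η * Fintype.card α ≤ S.card ∧ η * Fintype.card α ≤ T.card ∧
      (1 - c) * Fintype.card α ≤ S.card + T.card

/-- All d|S| edges at `S` end in the complement of `T`, which meets only d|Tᶜ| edges. -/
theorem IsBiregular.card_add_card_le {d : ℕ} (hd : 0 < d) {E : Finset (α × β)}
    (hE : IsBiregular d E) {S : Finset α} {T : Finset β} (hST : edgesBetween E S T = ∅) :
    S.card + T.card ≤ Fintype.card β := by
  have h1 := hE.card_edgesBetween_compl_right S T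
  have h2 := hE.card_edgesBetween_compl_left S Tᶜ
  rw [hST, Finset.card_empty, zero_add] at h1
  have h3 : S.card ≤ Tᶜ.card := Nat.le_of_mul_le_mul_left
    (h1.symm.trans_le (h2 ▸ Nat.le_add_right _ _)) hd
  have h4 := Finset.card_add_card_compl T
  omega

theorem card_nonexpandingGraphs_le {d N : ℕ} (hd : 3 ≤ d) (hα : Fintype.card α = N)
    (hβ : Fintype.card β = N) {η c x : ℝ} (hη : 0 < η) (hη1 : η ≤ 1) (hx : 0 < x) (hx1 : x ≤ 1)
    (hN : 4 * d ≤ η * N) :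
    ((nonexpandingGraphs α β d η c).card : ℝ) ≤ (2 / η) ^ (4 * d) * (N + 1) ^ (d + 2) *
      (((2 / η) ^ 2 * (x⁻¹) ^ d) ^ c * (1 + x) ^ d * (2 ^ (η / 2))⁻¹) ^ N *
        (biregularGraphs α β d).card := by
  classical
  set good : Finset (Finset α × Finset β) := Finset.univ.filter fun p =>
    η * N ≤ p.1.card ∧ η * N ≤ p.2.card ∧ p.1.card + p.2.card ≤ N ∧
      (1 - c) * N ≤ p.1.card + p.2.card with hgood
  set Q : ℝ := (2 / η) ^ (4 * d) * (N + 1) ^ d *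
      ((((2 / η) ^ 2 * (x⁻¹) ^ d) ^ c * (1 + x) ^ d) ^ N * (biregularGraphs α β d).card) *
      (2 ^ (η / 2 * N))⁻¹ with hQ
  have hsub : nonexpandingGraphs α β d η c ⊆ good.biUnion fun p => biregularWith d p.1 p.2 0 := by
    intro E hE
    obtain ⟨hE, S, T, hST, h1, h2, h3⟩ := Finset.mem_filter.1 hE
    rw [mem_biregularGraphs] at hE
    have h4 := hE.card_add_card_le (by omega) hST
    rw [hα] at h1 h2 h3
    rw [hβ] at h4
    refine Finset.mem_biUnion.2 ⟨(S, T), ?_, mem_biregularWith.2 ⟨hE, by simp [hST]⟩⟩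
    simp only [hgood, Finset.mem_filter, Finset.mem_univ, true_and]
    exact ⟨h1, h2, h4, h3⟩
  have hQ0 : 0 ≤ Q := by positivity
  have hterm : ∀ p ∈ good, ((biregularWith d p.1 p.2 0).card : ℝ) ≤
      Q * ((N.choose p.1.card : ℝ)⁻¹ * (N.choose p.2.card : ℝ)⁻¹) := by
    intro p hp
    simp only [hgood, Finset.mem_filter, Finset.mem_univ, true_and] at hp
    have := choose_mul_choose_mul_card_le hd hβ hη hη1 hx hx1 hp.1 hp.2.1 hp.2.2.1 hp.2.2.2 hN
    have h1 : (0 : ℝ) < N.choose p.1.card := by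
      exact_mod_cast Nat.choose_pos (by omega)
    have h2 : (0 : ℝ) < N.choose p.2.card := by
      exact_mod_cast Nat.choose_pos (by omega)
    have h3 : (0 : ℝ) < 2 ^ (η / 2 * N) := by positivity
    rw [← mul_inv, ← div_eq_mul_inv, le_div_iff₀ (by positivity), hQ, ← div_eq_mul_inv,
      le_div_iff₀ h3]
    linarith
  calc ((nonexpandingGraphs α β d η c).card : ℝ)
      ≤ ∑ p ∈ good, ((biregularWith d p.1 p.2 0).card : ℝ) := by
        exact_mod_cast (Finset.card_le_card hsub).trans Finset.card_biUnion_le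
    _ ≤ ∑ p ∈ good, Q * ((N.choose p.1.card : ℝ)⁻¹ * (N.choose p.2.card : ℝ)⁻¹) :=
        Finset.sum_le_sum hterm
    _ ≤ ∑ p : Finset α × Finset β,
          Q * ((N.choose p.1.card : ℝ)⁻¹ * (N.choose p.2.card : ℝ)⁻¹) :=
        Finset.sum_le_sum_of_subset_of_nonneg (Finset.subset_univ _)
          fun p _ _ => by positivity
    _ = Q * ((N + 1) * (N + 1)) := by
        have h1 := sum_inv_choose_card α
        have h2 := sum_inv_choose_card β
        rw [hα] at h1
        rw [hβ] at h2
        rw [← Finset.mul_sum, Fintype.sum_prod_type]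
        simp only
        rw [← Finset.sum_mul_sum, h1, h2]
    _ = _ := by
        rw [hQ, Real.rpow_mul (by norm_num), Real.rpow_natCast, mul_pow _ (_⁻¹), inv_pow]
        ring

/-- Almost all `d`-regular bipartite graphs are expanding. -/
theorem exists_card_nonexpandingGraphs_le {d : ℕ} (hd : 3 ≤ d) {η : ℝ} (hη : 0 < η) (hη1 : η ≤ 1) :
    ∃ c : ℝ, 0 < c ∧ ∃ r : ℕ → ℝ, Tendsto r atTop (𝓝 0) ∧ ∀ᶠ N in atTop,
      ((nonexpandingGraphs (Fin N) (Fin N) d η c).card : ℝ) ≤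
        r N * (biregularGraphs (Fin N) (Fin N) d).card := by
  have hb : (2 ^ (η / 2) : ℝ)⁻¹ < 1 :=
    inv_lt_one_of_one_lt₀ (Real.one_lt_rpow one_lt_two (by positivity))
  -- The order of choice matters: x is taken small against the gain 2^(η/2), and only then c, small
  -- in terms of M, which depends on x.
  obtain ⟨x, hx0, hx1, hx⟩ : ∃ x : ℝ, 0 < x ∧ x ≤ 1 ∧ (1 + x) ^ d * (2 ^ (η / 2) : ℝ)⁻¹ < 1 := by
    have hcont : Tendsto (fun x : ℝ => (1 + x) ^ d * (2 ^ (η / 2) : ℝ)⁻¹) (𝓝 0)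
        (𝓝 ((1 + 0) ^ d * (2 ^ (η / 2) : ℝ)⁻¹)) :=
      Continuous.tendsto (by fun_prop) 0
    have h1 := (hcont.eventually_lt_const (by simpa using hb)).filter_mono
      (nhdsWithin_le_nhds (s := Set.Ioi 0))
    obtain ⟨x, hx, hx'⟩ := (h1.and (Ioc_mem_nhdsGT one_pos)).exists
    exact ⟨x, hx'.1, hx'.2, hx⟩
  set M : ℝ := (2 / η) ^ 2 * (x⁻¹) ^ d with hM
  have hM0 : 0 < M := by positivity
  obtain ⟨c, hc0, hc⟩ : ∃ c : ℝ, 0 < c ∧ M ^ c * (1 + x) ^ d * (2 ^ (η / 2) : ℝ)⁻¹ < 1 := by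
    have hcont : Tendsto (fun c : ℝ => M ^ c * (1 + x) ^ d * (2 ^ (η / 2) : ℝ)⁻¹) (𝓝 0)
        (𝓝 (M ^ (0 : ℝ) * (1 + x) ^ d * (2 ^ (η / 2) : ℝ)⁻¹)) :=
      (((Real.continuous_const_rpow hM0.ne').mul continuous_const).mul
        continuous_const).tendsto 0
    have h1 := (hcont.eventually_lt_const (by simpa using hx)).filter_mono
      (nhdsWithin_le_nhds (s := Set.Ioi 0))
    obtain ⟨c, hc, hc'⟩ := (h1.and self_mem_nhdsWithin).exists
    exact ⟨c, hc', hc⟩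
  set ρ : ℝ := M ^ c * (1 + x) ^ d * (2 ^ (η / 2) : ℝ)⁻¹ with hρ
  have hρ0 : 0 < ρ := by positivity
  refine ⟨c, hc0, fun N => (2 / η) ^ (4 * d) * ((N : ℝ) + 1) ^ (d + 2) * ρ ^ N, ?_, ?_⟩
  · have h1 := tendsto_pow_const_mul_const_pow_of_abs_lt_one (d + 2)
      (show |ρ| < 1 by rwa [abs_of_pos hρ0])
    -- The standard limit is used at N + 1 to match (N + 1)^(d+2); the factor ρ⁻¹ undoes the extra
    -- power of ρ.
    have h2 := ((tendsto_add_atTop_iff_nat 1).2 h1).const_mul ((2 / η) ^ (4 * d) * ρ⁻¹)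
    rw [mul_zero] at h2
    refine h2.congr fun N => ?_
    push_cast
    field_simp
    ring
  · have h1 : ∀ᶠ N : ℕ in atTop, (4 * d : ℝ) / η ≤ N :=
      tendsto_natCast_atTop_atTop.eventually_ge_atTop _
    filter_upwards [h1] with N hN
    refine card_nonexpandingGraphs_le hd (by simp) (by simp) hη hη1 hx0 hx1 ?_
    rwa [div_le_iff₀ hη, mul_comm (N : ℝ)] at hN

end FirstMoment

/-! ### From edge sets back to simple graphs -/

section Transfer

variable {N : ℕ}

open Classical in
/-- The edges of a bipartite graph, as pairs of a left and a right vertex. -/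
noncomputable def crossEdges (G : SimpleGraph (Fin N ⊕ Fin N)) : Finset (Fin N × Fin N) :=
  Finset.univ.filter fun p => G.Adj (Sum.inl p.1) (Sum.inr p.2)

theorem mem_crossEdges {G : SimpleGraph (Fin N ⊕ Fin N)} {p : Fin N × Fin N} :
    p ∈ crossEdges G ↔ G.Adj (Sum.inl p.1) (Sum.inr p.2) := by
  simp [crossEdges]

/-- The bipartite graph with a given set of edges. -/
def bipartiteGraphOf (E : Finset (Fin N × Fin N)) : SimpleGraph (Fin N ⊕ Fin N) where
  Adj x y := (∃ p ∈ E, x = Sum.inl p.1 ∧ y = Sum.inr p.2) ∨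
    ∃ p ∈ E, y = Sum.inl p.1 ∧ x = Sum.inr p.2
  symm := ⟨fun _ _ h => h.symm⟩
  loopless := ⟨by
    rintro x (⟨p, -, h, h'⟩ | ⟨p, -, h, h'⟩) <;> exact Sum.inl_ne_inr (h.symm.trans h')⟩

theorem crossEdges_bipartiteGraphOf (E : Finset (Fin N × Fin N)) :
    crossEdges (bipartiteGraphOf E) = E := by
  ext ⟨i, j⟩
  simp [mem_crossEdges, bipartiteGraphOf]

theorem isBipartiteWith_bipartiteGraphOf (E : Finset (Fin N × Fin N)) :
    (bipartiteGraphOf E).IsBipartiteWith (Set.range Sum.inl) (Set.range Sum.inr) where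
  disjoint := by
    rw [Set.disjoint_left]; rintro _ ⟨i, rfl⟩ ⟨j, h⟩; exact Sum.inr_ne_inl h
  mem_of_adj := by
    rintro v w (⟨p, -, rfl, rfl⟩ | ⟨p, -, rfl, rfl⟩) <;> simp

theorem ncard_neighborSet_inl {G : SimpleGraph (Fin N ⊕ Fin N)}
    (hG : G.IsBipartiteWith (Set.range Sum.inl) (Set.range Sum.inr)) (i : Fin N) :
    (G.neighborSet (Sum.inl i)).ncard = ((crossEdges G).filter fun p => p.1 = i).card := by
  rw [← Set.ncard_coe_finset]
  symm
  refine Set.ncard_congr (fun p _ => Sum.inr p.2) ?_ ?_ ?_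
  · rintro ⟨i', j⟩ h
    simp only [Finset.coe_filter, Set.mem_ofPred_eq, mem_crossEdges] at h
    obtain ⟨h, rfl⟩ := h
    exact h
  · rintro ⟨a, b⟩ ⟨a', b'⟩ h h' hab
    simp only [Finset.coe_filter, Set.mem_ofPred_eq] at h h'
    exact Prod.ext (h.2.trans h'.2.symm) (Sum.inr_injective hab)
  · intro v hv
    rcases hG.mem_of_adj hv with ⟨-, j, rfl⟩ | ⟨⟨j, h⟩, -⟩
    · exact ⟨(i, j), by simpa [mem_crossEdges] using hv, rfl⟩
    · exact absurd h Sum.inr_ne_inl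

theorem ncard_neighborSet_inr {G : SimpleGraph (Fin N ⊕ Fin N)}
    (hG : G.IsBipartiteWith (Set.range Sum.inl) (Set.range Sum.inr)) (j : Fin N) :
    (G.neighborSet (Sum.inr j)).ncard = ((crossEdges G).filter fun p => p.2 = j).card := by
  rw [← Set.ncard_coe_finset]
  symm
  refine Set.ncard_congr (fun p _ => Sum.inl p.1) ?_ ?_ ?_
  · rintro ⟨i, j'⟩ h
    simp only [Finset.coe_filter, Set.mem_ofPred_eq, mem_crossEdges] at h
    obtain ⟨h, rfl⟩ := h
    exact h.symm
  · rintro ⟨a, b⟩ ⟨a', b'⟩ h h' hab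
    simp only [Finset.coe_filter, Set.mem_ofPred_eq] at h h'
    exact Prod.ext (Sum.inl_injective hab) (h.2.trans h'.2.symm)
  · intro v hv
    rcases hG.mem_of_adj hv with ⟨⟨i, h⟩, -⟩ | ⟨-, i, rfl⟩
    · exact absurd h Sum.inl_ne_inr
    · exact ⟨(i, j), by simpa [mem_crossEdges] using hv.symm, rfl⟩

theorem mem_regularBipartiteGraphs_iff {d : ℕ} {G : SimpleGraph (Fin N ⊕ Fin N)} :
    G ∈ regularBipartiteGraphs d N ↔
      G.IsBipartiteWith (Set.range Sum.inl) (Set.range Sum.inr) ∧ IsBiregular d (crossEdges G) := by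
  refine and_congr_right fun hG => ?_
  rw [Sum.forall, IsBiregular]
  simp_rw [ncard_neighborSet_inl hG, ncard_neighborSet_inr hG]

theorem injOn_crossEdges (d : ℕ) : Set.InjOn crossEdges (regularBipartiteGraphs d N) := by
  intro G hG H hH h
  have hadj : ∀ i j, G.Adj (Sum.inl i) (Sum.inr j) ↔ H.Adj (Sum.inl i) (Sum.inr j) := fun i j => by
    rw [← mem_crossEdges (p := (i, j)), h, mem_crossEdges]
  have hno : ∀ K ∈ regularBipartiteGraphs d N, (∀ i j, ¬ K.Adj (Sum.inl i) (Sum.inl j)) ∧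
      ∀ i j, ¬ K.Adj (Sum.inr i) (Sum.inr j) := fun K hK =>
    ⟨fun i j hij => by rcases hK.1.mem_of_adj hij with h | h <;> simp at h,
      fun i j hij => by rcases hK.1.mem_of_adj hij with h | h <;> simp at h⟩
  ext x y
  rcases x with i | i <;> rcases y with j | j
  · simp [(hno G hG).1, (hno H hH).1]
  · exact hadj i j
  · rw [G.adj_comm, H.adj_comm]; exact hadj j i
  · simp [(hno G hG).2, (hno H hH).2]

theorem image_crossEdges (d : ℕ) : crossEdges '' regularBipartiteGraphs d N
    = (biregularGraphs (Fin N) (Fin N) d : Set (Finset (Fin N × Fin N))) := by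
  ext E
  constructor
  · rintro ⟨G, hG, rfl⟩
    exact mem_biregularGraphs.2 (mem_regularBipartiteGraphs_iff.1 hG).2
  · intro hE
    refine ⟨bipartiteGraphOf E, mem_regularBipartiteGraphs_iff.2
      ⟨isBipartiteWith_bipartiteGraphOf E, ?_⟩, crossEdges_bipartiteGraphOf E⟩
    rw [crossEdges_bipartiteGraphOf]
    exact mem_biregularGraphs.1 hE

theorem ncard_regularBipartiteGraphs (d N : ℕ) :
    (regularBipartiteGraphs d N).ncard = (biregularGraphs (Fin N) (Fin N) d).card := by
  rw [← Set.ncard_coe_finset, ← image_crossEdges, (injOn_crossEdges d).ncard_image]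

/-- The circulant graph is `d`-regular. -/
theorem card_biregularGraphs_pos {d N : ℕ} (hdN : d ≤ N) :
    0 < (biregularGraphs (Fin N) (Fin N) d).card := by
  rcases Nat.eq_zero_or_pos N with rfl | hN
  · exact Finset.card_pos.2 ⟨∅, mem_biregularGraphs.2 ⟨fun i => i.elim0, fun i => i.elim0⟩⟩
  have : NeZero N := ⟨hN.ne'⟩
  have hcard : (Finset.univ.filter fun k : Fin N => (k : ℕ) < d).card = d := by
    rw [Fin.card_filter_val_lt]; exact min_eq_right hdN
  refine Finset.card_pos.2 ⟨Finset.univ.filter fun p : Fin N × Fin N =>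
      ((p.2 - p.1 : Fin N) : ℕ) < d,
    mem_biregularGraphs.2 ⟨fun i => ?_, fun j => ?_⟩⟩
  · refine (Finset.card_bij' (fun p _ => p.2 - p.1) (fun k _ => (i, k + i)) ?_ ?_ ?_ ?_).trans hcard
    · simp only [Finset.mem_filter, Finset.mem_univ, true_and]; exact fun p hp => hp.1
    · simp
    · rintro ⟨a, b⟩ h
      obtain rfl : a = i := by simpa using (Finset.mem_filter.1 h).2
      simp
    · simp
  · refine (Finset.card_bij' (fun p _ => p.2 - p.1) (fun k _ => (j - k, j)) ?_ ?_ ?_ ?_).trans hcard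
    · simp only [Finset.mem_filter, Finset.mem_univ, true_and]; exact fun p hp => hp.1
    · simp
    · rintro ⟨a, b⟩ h
      obtain rfl : b = j := by simpa using (Finset.mem_filter.1 h).2
      simp
    · simp

/-- A property that holds for all expanding regular bipartite graphs has probability close
to one. -/
theorem one_sub_le_probRegularBipartite {d : ℕ} (hdN : d ≤ N) {η c r : ℝ}
    (hr : ((nonexpandingGraphs (Fin N) (Fin N) d η c).card : ℝ) ≤
      r * (biregularGraphs (Fin N) (Fin N) d).card) {Q : SimpleGraph (Fin N ⊕ Fin N) → Prop}
    (hQ : ∀ G ∈ regularBipartiteGraphs d N,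
      crossEdges G ∉ nonexpandingGraphs (Fin N) (Fin N) d η c → Q G) :
    1 - r ≤ probRegularBipartite d N Q := by
  have hpos : (0 : ℝ) < (biregularGraphs (Fin N) (Fin N) d).card := by
    exact_mod_cast card_biregularGraphs_pos hdN
  have hbad : {G ∈ regularBipartiteGraphs d N | ¬ Q G}.ncard ≤
      (nonexpandingGraphs (Fin N) (Fin N) d η c).card := by
    rw [← Set.ncard_coe_finset]
    refine Set.ncard_le_ncard_of_injOn crossEdges (fun G hG => ?_)
      ((injOn_crossEdges d).mono fun G hG => hG.1) (Finset.finite_toSet _)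
    by_contra h
    exact hG.2 (hQ G hG.1 h)
  have hsplit : (regularBipartiteGraphs d N).ncard ≤
      {G ∈ regularBipartiteGraphs d N | Q G}.ncard +
        {G ∈ regularBipartiteGraphs d N | ¬ Q G}.ncard := by
    refine le_trans (Set.ncard_le_ncard (fun G hG => ?_) (Set.toFinite _)) (Set.ncard_union_le _ _)
    by_cases h : Q G
    · exact Or.inl ⟨hG, h⟩
    · exact Or.inr ⟨hG, h⟩
  rw [ncard_regularBipartiteGraphs] at hsplit
  rw [probRegularBipartite, ncard_regularBipartiteGraphs, le_div_iff₀ hpos]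
  have h1 : ((biregularGraphs (Fin N) (Fin N) d).card : ℝ) ≤
      ({G ∈ regularBipartiteGraphs d N | Q G}.ncard : ℝ) +
        (nonexpandingGraphs (Fin N) (Fin N) d η c).card := by
    exact_mod_cast hsplit.trans (Nat.add_le_add_left hbad _)
  linarith

theorem probRegularBipartite_le_one (d N : ℕ) (Q : SimpleGraph (Fin N ⊕ Fin N) → Prop) :
    probRegularBipartite d N Q ≤ 1 :=
  div_le_one_of_le₀ (by exact_mod_cast Set.ncard_le_ncard (Set.sep_subset _ _) (Set.toFinite _))
    (Nat.cast_nonneg _)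

/-- On an expanding regular bipartite graph, a randomized algorithm whose seeds have bounded
influence does not produce an independent set with homogeneous density close to one half. -/
theorem not_homogeneousDensityAtLeast_of_expanding {d : ℕ} (hd : 0 < d) (hN : 0 < N)
    {G : SimpleGraph (Fin N ⊕ Fin N)} (hG : G ∈ regularBipartiteGraphs d N) {δ η c ε : ℝ}
    (hGe : crossEdges G ∉ nonexpandingGraphs (Fin N) (Fin N) d η c)
    (A : SeedAlgorithm.{u, w} (Fin N ⊕ Fin N)) (hδ : δ ≤ 1) (hη : 0 < η) (hc : 0 < c)
    (hε : (4 + 2 * c⁻¹) * ε + 4 * η + 4 * ε ^ 2 < δ) (hA : A.InfluenceAtMost (1 - δ))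
    (hI : A.ProducesIndepSet G) : ¬ A.HomogeneousDensityAtLeast (1 / 2 - ε) := by
  classical
  refine A.not_homogeneousDensityAtLeast hN hδ hη hc hε hA ?_
  have hE := (mem_regularBipartiteGraphs_iff.1 hG).2
  filter_upwards [hI] with ω hω
  set S : Finset (Fin N) := Finset.univ.filter fun i => Sum.inl i ∈ A.outputSet ω with hS
  set T : Finset (Fin N) := Finset.univ.filter fun j => Sum.inr j ∈ A.outputSet ω with hT
  have hST : edgesBetween (crossEdges G) S T = ∅ := by
    refine Finset.eq_empty_of_forall_notMem fun p hp => ?_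
    obtain ⟨h1, h2, h3⟩ := mem_edgesBetween.1 hp
    exact hω (Finset.mem_filter.1 h2).2 (Finset.mem_filter.1 h3).2 Sum.inl_ne_inr
      (mem_crossEdges.1 h1)
  refine ⟨S, T, by simp [hS], by simp [hT], ?_, ?_⟩
  · simpa using hE.card_add_card_le hd hST
  · by_contra! h
    refine hGe (Finset.mem_filter.2 ⟨mem_biregularGraphs.2 hE, S, T, hST, ?_⟩)
    simpa using h

end Transfer

/-! ### Choice of the constants -/

theorem theorem5p1 (d : ℕ) (hd : 3 ≤ d) (δ : ℝ) (hδ : 0 < δ) :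
    ∃ ε : ℝ, 0 < ε ∧
      Tendsto
        (fun N : ℕ => probRegularBipartite d N (fun G =>
          ¬ ∃ A : SeedAlgorithm.{u, w} (Fin N ⊕ Fin N),
            A.InfluenceAtMost (1 - δ) ∧ A.ProducesIndepSet G ∧
              A.HomogeneousDensityAtLeast (1 / 2 - ε)))
        atTop (𝓝 1) := by
  -- The variance bound needs 1 − δ ≥ 0; capping δ only weakens the influence hypothesis.
  set δ' := min δ 1 with hδ'
  have hδ0 : 0 < δ' := lt_min hδ one_pos
  have hδ1 : δ' ≤ 1 := min_le_right _ _
  have hη : 0 < δ' / 16 := by positivity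
  obtain ⟨c, hc, r, hr, hle⟩ := exists_card_nonexpandingGraphs_le hd hη (by linarith)
  have hB : 0 < 8 + 2 * c⁻¹ := by positivity
  -- As ε ≤ 1, (4 + 2c⁻¹)ε + 4ε² ≤ (8 + 2c⁻¹)ε ≤ δ'/2, and η = δ'/16 adds δ'/4, for a total below
  -- δ'. Since c comes from d and η alone, ε depends only on d and δ.
  set ε := min 1 (δ' / (2 * (8 + 2 * c⁻¹))) with hεdef
  have hε0 : 0 < ε := lt_min one_pos (by positivity)
  have hε1 : ε ≤ 1 := min_le_left _ _
  have hε2 : (8 + 2 * c⁻¹) * ε ≤ δ' / 2 := by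
    calc (8 + 2 * c⁻¹) * ε ≤ (8 + 2 * c⁻¹) * (δ' / (2 * (8 + 2 * c⁻¹))) := by
          gcongr; exact min_le_right _ _
      _ = δ' / 2 := by field_simp
  have hε : (4 + 2 * c⁻¹) * ε + 4 * (δ' / 16) + 4 * ε ^ 2 < δ' := by nlinarith
  refine ⟨ε, hε0, ?_⟩
  refine tendsto_of_tendsto_of_tendsto_of_le_of_le' (g := fun N => 1 - r N)
    (by simpa using hr.const_sub 1) tendsto_const_nhds ?_
    (Eventually.of_forall fun N => probRegularBipartite_le_one d N _)
  filter_upwards [hle, eventually_ge_atTop d] with N hN hdN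
  refine one_sub_le_probRegularBipartite hdN hN fun G hG hGe => ?_
  rintro ⟨A, hA, hI, hD⟩
  refine not_homogeneousDensityAtLeast_of_expanding (by omega) (by omega) hG hGe A hδ1 hη hc hε
    (fun i => (hA i).trans ?_) hI hD
  have : δ' ≤ δ := min_le_left _ _
  gcongr
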